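/- Let $d \ge 1$. For $v \in \mathbb{S}^{d-1}$ and $\vartheta \in (0,\frac{\pi}{2}]$ let $\widetilde V(v,\vartheta) = \{h \in \mathbb{R}^d : h \neq 0,\ \langle v,h\rangle/|h| > \cos\vartheta\}$ and call $V(v,\vartheta) = \widetilde V(v,\vartheta) \cup (-\widetilde V(v,\vartheta))$ the double cone with symmetry axis $v$ and apex angle $\vartheta$. A configuration is a map $\Gamma$ that assigns to each $x \in \mathbb{R}^d$ a double cone $\Gamma(x)$ (with its apex angle); write $V^\Gamma[x] = x + \Gamma(x)$. For $\vartheta > 0$, the configuration $\Gamma$ is $\vartheta$-bounded if the infimum of the apex angles of all $\Gamma(x)$, $x \in \mathbb{R}^d$, equals $\vartheta$. $B_R(x_0)$ denotes the open Euclidean ball. **Theorem.** Let $d \ge 1$, $\Lambda \ge 1$, $\vartheta \in (0,\frac{\pi}{2}]$ and $R_0 > 0$. There are constants $\kappa \ge 1$ and $c \ge 1$, depending only on $\Lambda, \vartheta, R_0$ and $d$, such that the following holds. Let $\alpha \in (0,2)$, let $\Gamma$ be a $\vartheta$-bounded configuration, and let $\omega : \mathbb{Z}^d \times \mathbb{Z}^d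 \to [0,\infty]$ satisfy $\omega(x,y) = \omega(y,x)$ for all $x,y\in\mathbb{Z}^d$ and $$\Lambda^{-1}\big(\mathbf{1}_{V^\Gamma[x]}(y) + \mathbf{1}_{V^\Gamma[y]}(x)\big)\,|x-y|^{-d-\alpha} \;\le\; \omega(x,y) \;\le\; \Lambda\,|x-y|^{-d-\alpha}$$ for all $x,y \in \mathbb{Z}^d$ with $|x-y| > R_0$. Then for every $R > 0$, every $x_0 \in \mathbb{R}^d$ and every function $f : B_{\kappa R}(x_0)\cap\mathbb{Z}^d \to \mathbb{R}$, $$\sum_{\substack{x,y \in B_R(x_0)\cap\mathbb{Z}^d \\ |x-y| > R_0}} (f(x)-f(y))^2\,|x-y|^{-d-\alpha} \;\le\; c \sum_{\substack{x,y \in B_{\kappa R}(x_0)\cap\mathbb{Z}^d \\ |x-y| > R_0}} (f(x)-f(y))^2\,\omega(x,y).$$ -/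

import Mathlib

open scoped ENNReal

noncomputable section

/-- `d`-dimensional Euclidean space `ℝ^d`. -/
abbrev Euc (d : ℕ) : Type := EuclideanSpace ℝ (Fin d)

/-- The integer lattice `ℤ^d`. -/
abbrev ZLat (d : ℕ) : Type := Fin d → ℤ

/-- The inclusion of the lattice `ℤ^d` into Euclidean space `ℝ^d`. -/
def ZLat.toEuc {d : ℕ} (x : ZLat d) : Euc d := WithLp.toLp 2 fun i => (x i : ℝ)

/-- A double cone with apex at the origin, given by a unit vector spanning its symmetry axis and
its apex angle in `(0, π/2]`. (The vectors `v` and `-v` give the same set of points.) -/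
structure DoubleCone (d : ℕ) where
  axis : Euc d
  norm_axis : ‖axis‖ = 1
  angle : ℝ
  angle_pos : 0 < angle
  angle_le : angle ≤ Real.pi / 2

/-- The open single cone `{h ≠ 0 | ⟨v, h⟩ / |h| > cos ϑ}`. -/
def singleCone {d : ℕ} (v : Euc d) (ϑ : ℝ) : Set (Euc d) :=
  {h | h ≠ 0 ∧ Real.cos ϑ < inner ℝ v h / ‖h‖}

/-- The set of points of a double cone: the union of the single cone and its reflection. -/
def DoubleCone.carrier {d : ℕ} (V : DoubleCone d) : Set (Euc d) :=
  singleCone V.axis V.angle ∪ {h | -h ∈ singleCone V.axis V.angle}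

/-- A configuration assigns a double cone to every point of `ℝ^d`. -/
abbrev Configuration (d : ℕ) : Type := Euc d → DoubleCone d

/-- The double cone of the configuration at `x`, shifted so that its apex is `x`. -/
def Configuration.cone {d : ℕ} (Γ : Configuration d) (x : Euc d) : Set (Euc d) :=
  {y | y - x ∈ (Γ x).carrier}

/-- `Γ` is `ϑ`-bounded: the infimum of all apex angles of `Γ` equals `ϑ` and is positive. -/
def Configuration.IsBounded {d : ℕ} (Γ : Configuration d) (ϑ : ℝ) : Prop :=
  0 < ϑ ∧ IsGLB (Set.range fun x => (Γ x).angle) ϑ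

/-- The kernel `|x - y|^(-d-α)`. -/
def stableKernel {d : ℕ} (α : ℝ) (x y : ZLat d) : ℝ :=
  ‖x.toEuc - y.toEuc‖ ^ (-(d : ℝ) - α)

open Classical in
/-- The number `1_{V^Γ[x]}(y) + 1_{V^Γ[y]}(x)`. -/
def coneCount {d : ℕ} (Γ : Configuration d) (x y : ZLat d) : ℝ :=
  (if y.toEuc ∈ Γ.cone x.toEuc then 1 else 0) + (if x.toEuc ∈ Γ.cone y.toEuc then 1 else 0)

/-- The pairs of lattice points in the open ball `B_R(x₀)` at distance greater than `R₀`. -/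
def farPairs {d : ℕ} (R₀ : ℝ) (x₀ : Euc d) (R : ℝ) : Set (ZLat d × ZLat d) :=
  {p | p.1.toEuc ∈ Metric.ball x₀ R ∧ p.2.toEuc ∈ Metric.ball x₀ R ∧
    R₀ < ‖p.1.toEuc - p.2.toEuc‖}

/-- The sum of `(f x - f y)^2 * w x y` over all pairs of lattice points `x, y` in `B_R(x₀)`
with `|x - y| > R₀`. -/
def discreteForm {d : ℕ} (R₀ : ℝ) (w : ZLat d → ZLat d → ℝ≥0∞) (f : ZLat d → ℝ) (x₀ : Euc d)
    (R : ℝ) : ℝ≥0∞ :=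
  ∑' p : farPairs R₀ x₀ R, ENNReal.ofReal ((f p.1.1 - f p.1.2) ^ 2) * w p.1.1 p.1.2

end

/-!
The form on the right only sees pairs `z, w` with `w` in the cone at `z`, and the cones vary
arbitrarily from point to point. The proof compares both forms one scale `s` at a time, by joining
any two points at distance less than `s` through many chains of boundedly many cone pairs whose
lengths are comparable to `s`.

Such chains come from growing balls. The cone at `x` contains a whole ball of radius `s`
(`DoubleCone.exists_ball_subset`), so `x` is joined to all of its points directly. Suppose `x` has
been joined to all points of a ball `B` of radius `r`, and let `z` lie in the slightly larger
concentric ball of radius `(1 + τ² / 8) r`, where `τ = (1 - cos ϑ) / 4`. One half of the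
double cone at `z`, whatever its axis, reaches directions whose angle with the direction towards the
centre of `B` is bounded away from `π / 2`, so the cone contains a ball inside `B` of radius proportional to `r`
(`DoubleCone.exists_ball_subset_inter_ball`). Hence `x` is joined to `z` as well, through a fixed
proportion of the lattice points of `B`. After a number of steps that depends only on the apex
angle, the ball contains all points at distance less than `s` from `x`. It is essential here that
the cones are double cones; no regularity of the configuration enters.

Averaging the squared increments over these chains, and bounding how often a cone pair is used,
gives the inequality at scale `s` (`exists_sum_sq_sub_le_coneIncrement`). It needs `s` to be large
enough for the small balls to contain many lattice points. Multiplying by `s ^ (-d - α)` and summing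
over dyadic scales gives the result (`exists_sum_sq_sub_mul_rpow_le`): a far pair on the left is
seen at the first scale exceeding its length, and on the right a pair at distance `r` occurs only at
scales at least proportional to `r`, whose weights add up to a multiple of `r ^ (-d - α)`. Since
`1 ≤ d + α ≤ d + 2`, all constants are uniform in `α`.
-/

/-! ### Double cones contain balls -/

/-- A quantitative form of membership in a double cone: the vectors whose component along the
axis is a sufficiently large part of their length. -/
theorem DoubleCone.mem_carrier_of_inner {d : ℕ} (V : DoubleCone d) {τ t : ℝ} (hτ : 0 < τ)
    (hV : Real.cos V.angle ≤ 1 - 4 * τ) (ht : 0 < t) {v h : Euc d}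
    (hv : v = V.axis ∨ v = -V.axis) (h1 : (1 - τ) * t ≤ inner ℝ v h)
    (h2 : ‖h‖ ≤ (1 + 2 * τ) * t) : h ∈ V.carrier := by
  have hcos : 0 ≤ Real.cos V.angle :=
    Real.cos_nonneg_of_mem_Icc ⟨by linarith [V.angle_pos, Real.pi_pos], V.angle_le⟩
  have hin : 0 < inner ℝ v h := lt_of_lt_of_le (mul_pos (by linarith) ht) h1
  have h0 : h ≠ 0 := by
    rintro rfl
    simp at hin
  have hn : 0 < ‖h‖ := norm_pos_iff.2 h0
  have key : Real.cos V.angle * ‖h‖ < inner ℝ v h := by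
    have : Real.cos V.angle * ‖h‖ ≤ (1 - 4 * τ) * ((1 + 2 * τ) * t) :=
      mul_le_mul hV h2 hn.le (by linarith)
    nlinarith [mul_pos hτ ht, mul_pos (mul_pos hτ hτ) ht]
  rcases hv with rfl | rfl
  · exact Or.inl ⟨h0, (lt_div_iff₀ hn).2 key⟩
  · refine Or.inr ⟨neg_ne_zero.2 h0, ?_⟩
    rw [norm_neg, inner_neg_right, ← inner_neg_left]
    exact (lt_div_iff₀ hn).2 key

/-- Every double cone contains a ball of any prescribed radius `s`, centred on its axis. -/
theorem DoubleCone.exists_ball_subset {d : ℕ} (V : DoubleCone d) {τ s : ℝ} (hτ : 0 < τ)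
    (hV : Real.cos V.angle ≤ 1 - 4 * τ) (hs : 0 < s) (x : Euc d) :
    ∃ c : Euc d, ‖c - x‖ = s / τ ∧ ∀ q : Euc d, ‖q - c‖ < s →
      q - x ∈ V.carrier ∧ s ≤ ‖x - q‖ ∧ ‖x - q‖ ≤ 2 * (s / τ) := by
  have hcos : 0 ≤ Real.cos V.angle :=
    Real.cos_nonneg_of_mem_Icc ⟨by linarith [V.angle_pos, Real.pi_pos], V.angle_le⟩
  set T := s / τ with hT
  have hT0 : 0 < T := div_pos hs hτ
  have hTs : s = τ * T := by rw [hT]; field_simp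
  have hcT : ‖T • V.axis‖ = T := by rw [norm_smul, V.norm_axis, mul_one, Real.norm_of_nonneg hT0.le]
  refine ⟨x + T • V.axis, by simpa using hcT, fun q hq => ?_⟩
  set e := q - (x + T • V.axis) with he
  have hqe : q - x = T • V.axis + e := by rw [he]; abel
  have hin : (1 - τ) * T ≤ inner ℝ V.axis (q - x) := by
    have h1 : inner ℝ V.axis (T • V.axis + e) = T + inner ℝ V.axis e := by
      rw [inner_add_right, inner_smul_right, real_inner_self_eq_norm_sq, V.norm_axis]; ring
    have h2 := abs_real_inner_le_norm V.axis e
    rw [V.norm_axis, one_mul] at h2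
    rw [hqe, h1]
    nlinarith [neg_abs_le (inner ℝ V.axis e)]
  have hnorm : ‖q - x‖ ≤ (1 + τ) * T := by
    rw [hqe]
    calc _ ≤ ‖T • V.axis‖ + ‖e‖ := norm_add_le _ _
      _ ≤ _ := by rw [hcT]; linarith
  have hlow : (1 - τ) * T ≤ ‖q - x‖ := by
    have := real_inner_le_norm V.axis (q - x)
    rw [V.norm_axis, one_mul] at this
    linarith
  rw [norm_sub_rev x q]
  have hτ4 : τ ≤ 1 / 4 := by linarith
  refine ⟨V.mem_carrier_of_inner hτ hV hT0 (Or.inl rfl) hin ?_, ?_, ?_⟩ <;> nlinarith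

/-- The left side is convex in `m`, so its maximum is attained at an end of the interval. -/
theorem sq_sub_mul_add_le {a s m : ℝ} (ha : 0 ≤ a) (ha1 : a ≤ 1) (hs : 0 ≤ s)
    (hm : 0 ≤ m) (hms : m ≤ (1 + a / 8) * s) :
    m ^ 2 - a * s * m + a * s ^ 2 / 2 ≤ ((1 - a / 16) * s) ^ 2 := by
  have hpos : 0 ≤ (1 + a / 8) * s - a * s := by
    have : 0 ≤ (1 - 7 * a / 8) * s := mul_nonneg (by linarith) hs
    linarith
  have h1 : m * m ≤ m * ((1 + a / 8) * s) := mul_le_mul_of_nonneg_left hms hm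
  have h2 : m * ((1 + a / 8) * s - a * s) ≤ (1 + a / 8) * s * ((1 + a / 8) * s - a * s) :=
    mul_le_mul_of_nonneg_right hms hpos
  have h3 : 0 ≤ (a / 8 + 29 * a ^ 2 / 256) * s ^ 2 := by positivity
  linarith

/-- A double cone with apex `z` inside a ball, or slightly outside of it, meets the ball
substantially: however the axis is oriented, one of its two halves leans towards the centre. -/
theorem DoubleCone.exists_ball_subset_inter_ball {d : ℕ} (V : DoubleCone d) {τ s : ℝ}
    (hτ : 0 < τ) (hV : Real.cos V.angle ≤ 1 - 4 * τ) (hs : 0 < s) {c z : Euc d}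
    (hz : ‖z - c‖ ≤ (1 + τ ^ 2 / 8) * s) :
    ∃ p : Euc d, ∀ q : Euc d, ‖q - p‖ < τ ^ 2 / 16 * s →
      ‖q - c‖ < s ∧ q - z ∈ V.carrier ∧ τ / 4 * s ≤ ‖z - q‖ ∧ ‖z - q‖ ≤ s := by
  have hcos : 0 ≤ Real.cos V.angle :=
    Real.cos_nonneg_of_mem_Icc ⟨by linarith [V.angle_pos, Real.pi_pos], V.angle_le⟩
  have hτ4 : τ ≤ 1 / 4 := by linarith
  obtain ⟨v, hv, hv1, hvc⟩ : ∃ v : Euc d, (v = V.axis ∨ v = -V.axis) ∧ ‖v‖ = 1 ∧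
      0 ≤ inner ℝ v (c - z) := by
    rcases le_total 0 (inner ℝ V.axis (c - z)) with h | h
    · exact ⟨_, Or.inl rfl, V.norm_axis, h⟩
    · exact ⟨_, Or.inr rfl, by rw [norm_neg, V.norm_axis], by rw [inner_neg_left]; linarith⟩
  -- `n` is the unit vector pointing from `z` to `c`, or `0` if the two points agree.
  obtain ⟨n, hn1, hnc, hnv⟩ : ∃ n : Euc d, ‖n‖ ≤ 1 ∧ inner ℝ n (c - z) = ‖z - c‖ ∧
      0 ≤ inner ℝ v n := by
    refine ⟨‖c - z‖⁻¹ • (c - z), ?_, ?_, ?_⟩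
    · rw [norm_smul, norm_inv, norm_norm]; exact inv_mul_le_one
    · rw [real_inner_smul_left, real_inner_self_eq_norm_sq, norm_sub_rev z c]
      rcases eq_or_ne ‖c - z‖ 0 with h | h
      · simp [h]
      · field_simp
    · rw [inner_smul_right]; positivity
  set m := ‖z - c‖ with hm
  set t := τ * s / 2 with ht
  have ht0 : 0 < t := by positivity
  set u := v + τ • n with hu
  have hun : ‖u‖ ≤ 1 + τ := by
    calc _ ≤ ‖v‖ + ‖τ • n‖ := norm_add_le _ _
      _ ≤ _ := by rw [norm_smul, hv1, Real.norm_of_nonneg hτ.le]; nlinarith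
  have huc : τ * m ≤ inner ℝ u (c - z) := by
    rw [hu, inner_add_left, real_inner_smul_left, hnc]; linarith
  have hvu : 1 ≤ inner ℝ v u := by
    rw [hu, inner_add_right, real_inner_self_eq_norm_sq, hv1, inner_smul_right]
    nlinarith [mul_nonneg hτ.le hnv]
  refine ⟨z + t • u, fun q hq => ?_⟩
  set e := q - (z + t • u) with he
  have hqe : q - z = t • u + e := by rw [he]; abel
  have htu : ‖t • u‖ ≤ t * (1 + τ) := by
    rw [norm_smul, Real.norm_of_nonneg ht0.le]; gcongr
  have het : ‖e‖ ≤ τ * t := by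
    rw [ht]; nlinarith [mul_pos (mul_pos hτ hτ) hs]
  have hin : (1 - τ) * t ≤ inner ℝ v (q - z) := by
    have h2 := abs_real_inner_le_norm v e
    rw [hv1, one_mul] at h2
    rw [hqe, inner_add_right, inner_smul_right]
    nlinarith [neg_abs_le (inner ℝ v e)]
  have hnorm : ‖q - z‖ ≤ (1 + 2 * τ) * t := by
    rw [hqe]
    calc _ ≤ ‖t • u‖ + ‖e‖ := norm_add_le _ _
      _ ≤ _ := by linarith
  have hlow : (1 - τ) * t ≤ ‖q - z‖ := by
    have := real_inner_le_norm v (q - z)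
    rw [hv1, one_mul] at this
    linarith
  have hτ1 : τ ^ 2 ≤ 1 := pow_le_one₀ hτ.le (by linarith)
  have hpc : ‖z + t • u - c‖ ≤ (1 - τ ^ 2 / 16) * s := by
    have hexp : ‖z + t • u - c‖ ^ 2 = m ^ 2 - 2 * t * inner ℝ u (c - z) + t ^ 2 * ‖u‖ ^ 2 := by
      have : z + t • u - c = t • u - (c - z) := by abel
      rw [this, norm_sub_sq_real, norm_smul, real_inner_smul_left, mul_pow, Real.norm_eq_abs,
        sq_abs, norm_sub_rev c z]
      ring
    have hu2 : ‖u‖ ^ 2 ≤ 2 := by nlinarith [norm_nonneg u]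
    have hm0 : 0 ≤ m := norm_nonneg _
    have hle : ‖z + t • u - c‖ ^ 2 ≤ m ^ 2 - 2 * t * (τ * m) + t ^ 2 * 2 := by
      rw [hexp]
      have h1 := mul_le_mul_of_nonneg_left huc ht0.le
      have h2 := mul_le_mul_of_nonneg_left hu2 (sq_nonneg t)
      linarith
    have hpoly : m ^ 2 - 2 * t * (τ * m) + t ^ 2 * 2 ≤ ((1 - τ ^ 2 / 16) * s) ^ 2 := by
      have h6 : 2 * t * (τ * m) = τ ^ 2 * s * m := by rw [ht]; ring
      have h7 : t ^ 2 * 2 = τ ^ 2 * s ^ 2 / 2 := by rw [ht]; ring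
      rw [h6, h7]
      exact sq_sub_mul_add_le (sq_nonneg τ) hτ1 hs.le hm0 hz
    exact le_of_sq_le_sq (hle.trans hpoly) (mul_nonneg (by linarith) hs.le)
  rw [norm_sub_rev z q]
  refine ⟨?_, V.mem_carrier_of_inner hτ hV ht0 hv hin hnorm, ?_, ?_⟩
  · have : q - c = e + (z + t • u - c) := by rw [he]; abel
    rw [this]
    linarith [norm_add_le e (z + t • u - c)]
  · have h1 : 0 ≤ (1 / 2 - τ) * (τ * s) := mul_nonneg (by linarith) (by positivity)
    rw [ht] at hlow
    linarith
  · have h1 : (1 + 2 * τ) * (τ / 2) * s ≤ 1 * s :=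
      mul_le_mul_of_nonneg_right (by nlinarith) hs.le
    rw [ht] at hnorm
    linarith

/-! ### Lattice points in balls -/

theorem ZLat.toEuc_apply {d : ℕ} (x : ZLat d) (i : Fin d) : x.toEuc i = x i := rfl

theorem ZLat.mem_piFinset_of_norm_lt {d : ℕ} {c : Euc d} {s : ℝ} {x : ZLat d}
    (hx : ‖x.toEuc - c‖ < s) :
    x ∈ Fintype.piFinset fun i => Finset.Icc ⌈c i - s⌉ ⌊c i + s⌋ := by
  refine Fintype.mem_piFinset.2 fun i => ?_
  have h := (PiLp.norm_apply_le (x.toEuc - c) i).trans_lt hx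
  rw [PiLp.sub_apply, ZLat.toEuc_apply, Real.norm_eq_abs, abs_lt] at h
  exact Finset.mem_Icc.2 ⟨Int.ceil_le.2 (by linarith), Int.le_floor.2 (by linarith)⟩

theorem ZLat.finite_ball {d : ℕ} (c : Euc d) (s : ℝ) :
    {x : ZLat d | ‖x.toEuc - c‖ < s}.Finite :=
  (Finset.finite_toSet _).subset fun _ hx => ZLat.mem_piFinset_of_norm_lt hx

/-- The lattice points in the open ball of radius `s` around `c`. -/
noncomputable def latticeBall {d : ℕ} (c : Euc d) (s : ℝ) : Finset (ZLat d) :=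
  (ZLat.finite_ball c s).toFinset

@[simp]
theorem mem_latticeBall {d : ℕ} {c : Euc d} {s : ℝ} {x : ZLat d} :
    x ∈ latticeBall c s ↔ ‖x.toEuc - c‖ < s := by
  simp [latticeBall]

theorem card_latticeBall_le {d : ℕ} (c : Euc d) {s : ℝ} (hs : 1 ≤ s) :
    ((latticeBall c s).card : ℝ) ≤ (3 * s) ^ d := by
  have hsub : latticeBall c s ⊆ Fintype.piFinset fun i => Finset.Icc ⌈c i - s⌉ ⌊c i + s⌋ :=
    fun _ hx => ZLat.mem_piFinset_of_norm_lt (mem_latticeBall.1 hx)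
  calc ((latticeBall c s).card : ℝ)
      ≤ ((Fintype.piFinset fun i => Finset.Icc ⌈c i - s⌉ ⌊c i + s⌋).card : ℝ) :=
        Nat.cast_le.2 (Finset.card_le_card hsub)
    _ = ∏ i : Fin d, ((Finset.Icc ⌈c i - s⌉ ⌊c i + s⌋).card : ℝ) := by
        rw [Fintype.card_piFinset]; push_cast; rfl
    _ ≤ ∏ _i : Fin d, 3 * s := by
        refine Finset.prod_le_prod (fun _ _ => Nat.cast_nonneg _) fun i _ => ?_
        rw [Int.card_Icc]
        have h1 := Int.le_ceil (c i - s)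
        have h2 := Int.floor_le (c i + s)
        have h3 : (((⌊c i + s⌋ + 1 - ⌈c i - s⌉).toNat : ℤ) : ℝ) ≤ 3 * s := by
          rw [Int.ofNat_toNat, Int.cast_max]
          push_cast
          exact max_le (by linarith) (by linarith)
        exact_mod_cast h3
    _ = (3 * s) ^ d := by simp

theorem le_card_latticeBall {d : ℕ} (c : Euc d) {s : ℝ} (hs : (d : ℝ) + 1 ≤ s) :
    (s / (d + 1)) ^ d ≤ ((latticeBall c s).card : ℝ) := by
  have hd : (0 : ℝ) < d + 1 := by positivity
  set h := s / (d + 1) with hh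
  have h1 : 1 ≤ h := (one_le_div hd).2 hs
  have hsh : s = (d + 1) * h := by rw [hh]; field_simp
  have hsub : (Fintype.piFinset fun i => Finset.Icc ⌈c i - h⌉ ⌊c i + h⌋) ⊆ latticeBall c s := by
    intro (x : ZLat d) hx
    rw [mem_latticeBall]
    have hcoord : ∀ i, ‖(x.toEuc - c) i‖ ≤ h := fun i => by
      have := Finset.mem_Icc.1 (Fintype.mem_piFinset.1 hx i)
      have ha := Int.ceil_le.1 this.1
      have hb := Int.le_floor.1 this.2
      rw [PiLp.sub_apply, ZLat.toEuc_apply, Real.norm_eq_abs, abs_le]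
      constructor <;> linarith
    have hsq : ‖x.toEuc - c‖ ^ 2 ≤ (d * h) ^ 2 := by
      rw [EuclideanSpace.norm_sq_eq]
      calc ∑ i, ‖(x.toEuc - c) i‖ ^ 2 ≤ ∑ _i : Fin d, h ^ 2 := by
            gcongr with i; exact hcoord i
        _ = d * h ^ 2 := by simp
        _ ≤ (d : ℝ) ^ 2 * h ^ 2 := by
            gcongr
            rcases Nat.eq_zero_or_pos d with h0 | h0
            · simp [h0]
            · exact_mod_cast Nat.le_self_pow two_ne_zero d
        _ = _ := by ring
    have := le_of_sq_le_sq hsq (by positivity)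
    linarith
  calc h ^ d = ∏ _i : Fin d, h := by simp
    _ ≤ ∏ i : Fin d, ((Finset.Icc ⌈c i - h⌉ ⌊c i + h⌋).card : ℝ) := by
        refine Finset.prod_le_prod (fun _ _ => by linarith) fun i _ => ?_
        rw [Int.card_Icc]
        have h2 := Int.ceil_lt_add_one (c i - h)
        have h3 := Int.lt_floor_add_one (c i + h)
        have h4 : h ≤ (((⌊c i + h⌋ + 1 - ⌈c i - h⌉).toNat : ℤ) : ℝ) := by
          rw [Int.ofNat_toNat, Int.cast_max]
          push_cast
          exact le_max_of_le_left (by linarith)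
        exact_mod_cast h4
    _ = ((Fintype.piFinset fun i => Finset.Icc ⌈c i - h⌉ ⌊c i + h⌋).card : ℝ) := by
        rw [Fintype.card_piFinset]; push_cast; rfl
    _ ≤ _ := Nat.cast_le.2 (Finset.card_le_card hsub)

/-! ### The inequality at a single scale -/

/-- If every `z ∈ B` is joined to at least `L` points of `A`, then the increments of `f` between
`x` and `B` are controlled by those between `x` and `A` and those along the joining pairs:
average `(f x - f z)² ≤ 2 (f x - f w)² + 2 (f z - f w)²` over the points `w` joined to `z`. -/
theorem mul_sum_sq_sub_le {P : Type*} (f : P → ℝ) (x : P) {A B : Finset P} {L : ℝ}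
    {E : P → P → ℝ} (hE : ∀ z w, 0 ≤ E z w)
    (h : ∀ z ∈ B, ∃ S ⊆ A, L ≤ (S.card : ℝ) ∧ ∀ w ∈ S, (f z - f w) ^ 2 ≤ E z w) :
    L * ∑ z ∈ B, (f x - f z) ^ 2 ≤
      2 * (B.card : ℝ) * ∑ w ∈ A, (f x - f w) ^ 2 + 2 * ∑ z ∈ B, ∑ w ∈ A, E z w := by
  have hz : ∀ z ∈ B, L * (f x - f z) ^ 2 ≤
      2 * ∑ w ∈ A, (f x - f w) ^ 2 + 2 * ∑ w ∈ A, E z w := by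
    intro z hzB
    obtain ⟨S, hSA, hL, hS⟩ := h z hzB
    calc L * (f x - f z) ^ 2 ≤ S.card * (f x - f z) ^ 2 := by gcongr
      _ = ∑ _w ∈ S, (f x - f z) ^ 2 := by simp
      _ ≤ ∑ w ∈ S, (2 * (f x - f w) ^ 2 + 2 * E z w) := by
          refine Finset.sum_le_sum fun w hw => ?_
          nlinarith [hS w hw, sq_nonneg ((f x - f w) + (f z - f w))]
      _ ≤ ∑ w ∈ A, (2 * (f x - f w) ^ 2 + 2 * E z w) :=
          Finset.sum_le_sum_of_subset_of_nonneg hSA fun w _ _ => by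
            have := hE z w
            positivity
      _ = _ := by rw [Finset.sum_add_distrib, Finset.mul_sum, Finset.mul_sum]
  calc L * ∑ z ∈ B, (f x - f z) ^ 2 = ∑ z ∈ B, L * (f x - f z) ^ 2 := Finset.mul_sum _ _ _
    _ ≤ ∑ z ∈ B, (2 * ∑ w ∈ A, (f x - f w) ^ 2 + 2 * ∑ w ∈ A, E z w) := Finset.sum_le_sum hz
    _ = _ := by
        rw [Finset.sum_add_distrib, Finset.sum_const, nsmul_eq_mul, ← Finset.mul_sum]
        ring

open Classical in
/-- The squared increment of `f` from `z` to `w`, counted only if `w` lies in the cone at `z` and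
at a distance between `a` and `b` from `z`. -/
noncomputable def coneIncrement {d : ℕ} (Γ : Configuration d) (f : ZLat d → ℝ) (a b : ℝ)
    (z w : ZLat d) : ℝ :=
  if w.toEuc ∈ Γ.cone z.toEuc ∧ a ≤ ‖z.toEuc - w.toEuc‖ ∧ ‖z.toEuc - w.toEuc‖ ≤ b then
    (f z - f w) ^ 2 else 0

theorem coneIncrement_nonneg {d : ℕ} (Γ : Configuration d) (f : ZLat d → ℝ) (a b : ℝ)
    (z w : ZLat d) : 0 ≤ coneIncrement Γ f a b z w := by
  unfold coneIncrement
  split_ifs <;> positivity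

theorem coneIncrement_eq {d : ℕ} {Γ : Configuration d} {f : ZLat d → ℝ} {a b : ℝ}
    {z w : ZLat d} (h : w.toEuc ∈ Γ.cone z.toEuc) (ha : a ≤ ‖z.toEuc - w.toEuc‖)
    (hb : ‖z.toEuc - w.toEuc‖ ≤ b) : coneIncrement Γ f a b z w = (f z - f w) ^ 2 :=
  if_pos ⟨h, ha, hb⟩

/-- The increments from `x` to all points at distance less than `s` are controlled by increments
inside cones. All points of some ball of radius `s` lie in the cone at `x`; since the cones at the
points near a ball reach back into it, this ball can be enlarged by a fixed factor, `N` times over,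
until it contains the neighbourhood of `x`. -/
theorem mul_sum_sq_sub_le_coneIncrement {d : ℕ} {Γ : Configuration d} {τ K C s : ℝ} {N : ℕ}
    (hτ : 0 < τ) (hΓ : ∀ x, Real.cos (Γ x).angle ≤ 1 - 4 * τ) (hK : K = (1 + τ ^ 2 / 8) ^ N)
    (hK2 : 2 / τ ≤ K) (hs : 1 ≤ s) (hsd : (d : ℝ) + 1 ≤ τ ^ 2 / 16 * s)
    (hC : (3 * (K * s)) ^ d ≤ C * (τ ^ 2 / 16 * s / (d + 1)) ^ d) (f : ZLat d → ℝ)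
    (x : ZLat d) :
    (τ ^ 2 / 16 * s / (d + 1)) ^ d * ∑ z ∈ latticeBall x.toEuc s, (f x - f z) ^ 2 ≤
      (2 * C + 2) ^ N * ((τ ^ 2 / 16 * s / (d + 1)) ^ d *
          ∑ w ∈ latticeBall x.toEuc (2 * K * s),
            coneIncrement Γ f (τ / 4 * s) (2 * K * s) x w +
        ∑ z ∈ latticeBall x.toEuc (2 * K * s), ∑ w ∈ latticeBall x.toEuc (2 * K * s),
          coneIncrement Γ f (τ / 4 * s) (2 * K * s) z w) := by
  have hcos : 0 ≤ Real.cos (Γ x.toEuc).angle :=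
    Real.cos_nonneg_of_mem_Icc
      ⟨by linarith [(Γ x.toEuc).angle_pos, Real.pi_pos], (Γ x.toEuc).angle_le⟩
  have hτ4 : τ ≤ 1 / 4 := by linarith [hΓ x.toEuc]
  have hs0 : 0 < s := by linarith
  have hg1 : 1 ≤ 1 + τ ^ 2 / 8 := by nlinarith [sq_nonneg τ]
  have hK1 : 1 ≤ K := hK ▸ one_le_pow₀ hg1
  have hKs : 2 * (s / τ) ≤ K * s := by
    calc 2 * (s / τ) = 2 / τ * s := by ring
      _ ≤ K * s := by gcongr
  have hsτ : s ≤ s / τ := by rw [le_div_iff₀ hτ]; nlinarith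
  obtain ⟨c, hc, hcone⟩ := (Γ x.toEuc).exists_ball_subset hτ (hΓ _) hs0 x.toEuc
  set L := (τ ^ 2 / 16 * s / (d + 1)) ^ d with hL
  have hL0 : 0 < L := by positivity
  have hC0 : 0 ≤ C := by
    have : 0 < C * L := lt_of_lt_of_le (by positivity) hC
    exact (pos_of_mul_pos_left this hL0.le).le
  set E := coneIncrement Γ f (τ / 4 * s) (2 * K * s) with hE
  have hE0 : ∀ z w, 0 ≤ E z w := coneIncrement_nonneg _ _ _ _
  set D := latticeBall x.toEuc (2 * K * s) with hD
  set I := ∑ z ∈ D, ∑ w ∈ D, E z w with hI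
  have hI0 : 0 ≤ I := Finset.sum_nonneg fun z _ => Finset.sum_nonneg fun w _ => hE0 z w
  have hballD : ∀ k ≤ N, latticeBall c ((1 + τ ^ 2 / 8) ^ k * s) ⊆ D := by
    intro k hk z hz
    rw [mem_latticeBall] at hz
    rw [hD, mem_latticeBall]
    have h1 : (1 + τ ^ 2 / 8) ^ k * s ≤ K * s := by
      rw [hK]; gcongr
    have h2 := norm_add_le (z.toEuc - c) (c - x.toEuc)
    rw [sub_add_sub_cancel, hc] at h2
    linarith
  set n : ℕ → ℝ := fun k =>
    ∑ z ∈ latticeBall c ((1 + τ ^ 2 / 8) ^ k * s), (f x - f z) ^ 2 with hn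
  have hn0 : ∀ k, 0 ≤ n k := fun k => Finset.sum_nonneg fun z _ => sq_nonneg _
  have hstart : n 0 ≤ ∑ w ∈ D, E x w := by
    calc n 0 = ∑ w ∈ latticeBall c ((1 + τ ^ 2 / 8) ^ 0 * s), E x w := by
          refine Finset.sum_congr rfl fun w hw => ?_
          rw [mem_latticeBall, pow_zero, one_mul] at hw
          obtain ⟨h1, h2, h3⟩ := hcone _ hw
          exact (coneIncrement_eq h1 (by nlinarith) (by nlinarith)).symm
      _ ≤ _ := Finset.sum_le_sum_of_subset_of_nonneg (hballD 0 (Nat.zero_le _))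
          fun w _ _ => hE0 x w
  have hstep : ∀ k < N, L * n (k + 1) ≤ 2 * (C * L) * n k + 2 * I := by
    intro k hk
    set r := (1 + τ ^ 2 / 8) ^ k * s with hr
    have hk1 : 1 ≤ (1 + τ ^ 2 / 8) ^ k := one_le_pow₀ hg1
    have hrs : s ≤ r := by rw [hr]; nlinarith
    have hr0 : 0 < r := by linarith
    have hrK : r ≤ K * s := by
      rw [hr, hK]; gcongr
    have hr1 : (1 + τ ^ 2 / 8) ^ (k + 1) * s = (1 + τ ^ 2 / 8) * r := by rw [hr]; ring
    have hr1K : (1 + τ ^ 2 / 8) * r ≤ K * s := by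
      rw [← hr1, hK]
      gcongr
      exact hk
    have hmain := mul_sum_sq_sub_le f x (A := latticeBall c r)
      (B := latticeBall c ((1 + τ ^ 2 / 8) * r)) (L := L) hE0 (by
        intro z hz
        rw [mem_latticeBall] at hz
        obtain ⟨p, hp⟩ := (Γ z.toEuc).exists_ball_subset_inter_ball hτ (hΓ _) hr0 hz.le
        refine ⟨latticeBall p (τ ^ 2 / 16 * r), fun w hw => ?_, ?_, fun w hw => ?_⟩
        · exact mem_latticeBall.2 (hp _ (mem_latticeBall.1 hw)).1
        · have h1 : τ ^ 2 / 16 * s ≤ τ ^ 2 / 16 * r := by gcongr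
          refine le_trans ?_ (le_card_latticeBall p (hsd.trans h1))
          rw [hL]; gcongr
        · obtain ⟨-, h1, h2, h3⟩ := hp _ (mem_latticeBall.1 hw)
          refine (coneIncrement_eq h1 (le_trans ?_ h2) (h3.trans ?_)).ge
          · gcongr
          · nlinarith)
    have hcard : ((latticeBall c ((1 + τ ^ 2 / 8) * r)).card : ℝ) ≤ C * L := by
      refine (card_latticeBall_le c (by nlinarith)).trans (le_trans ?_ hC)
      gcongr
    have hsum : ∑ z ∈ latticeBall c ((1 + τ ^ 2 / 8) * r), ∑ w ∈ latticeBall c r, E z w ≤ I := by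
      have hB : latticeBall c ((1 + τ ^ 2 / 8) * r) ⊆ D := by
        rw [← hr1]; exact hballD _ hk
      calc _ ≤ ∑ z ∈ latticeBall c ((1 + τ ^ 2 / 8) * r), ∑ w ∈ D, E z w :=
            Finset.sum_le_sum fun z _ => Finset.sum_le_sum_of_subset_of_nonneg
              (hballD k hk.le) fun w _ _ => hE0 z w
        _ ≤ _ := Finset.sum_le_sum_of_subset_of_nonneg hB fun z _ _ =>
            Finset.sum_nonneg fun w _ => hE0 z w
    have hnk : n (k + 1) = ∑ z ∈ latticeBall c ((1 + τ ^ 2 / 8) * r), (f x - f z) ^ 2 := by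
      rw [hn]; simp only [hr1]
    rw [hnk]
    refine hmain.trans ?_
    have := hn0 k
    gcongr
  have hind : ∀ k ≤ N, L * n k ≤ (2 * C + 2) ^ k * (L * n 0 + I) := by
    intro k
    induction k with
    | zero => intro _; rw [pow_zero]; linarith
    | succ k ih =>
      intro hk
      have h1 := hstep k hk
      have h2 := ih (Nat.le_of_succ_le hk)
      have h3 : 1 ≤ (2 * C + 2) ^ k := one_le_pow₀ (by linarith)
      have h4 : 0 ≤ L * n 0 := mul_nonneg hL0.le (hn0 0)
      calc L * n (k + 1) ≤ 2 * C * (L * n k) + 2 * I := by linarith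
        _ ≤ 2 * C * ((2 * C + 2) ^ k * (L * n 0 + I)) + 2 * ((2 * C + 2) ^ k * (L * n 0 + I)) := by
            gcongr
            nlinarith
        _ = _ := by ring
  have hcover : latticeBall x.toEuc s ⊆ latticeBall c ((1 + τ ^ 2 / 8) ^ N * s) := by
    intro z hz
    rw [mem_latticeBall] at hz ⊢
    rw [← hK]
    have h2 := norm_add_le (z.toEuc - x.toEuc) (x.toEuc - c)
    rw [sub_add_sub_cancel, norm_sub_rev x.toEuc c, hc] at h2
    linarith
  calc L * ∑ z ∈ latticeBall x.toEuc s, (f x - f z) ^ 2 ≤ L * n N := by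
        gcongr
        exact Finset.sum_le_sum_of_subset_of_nonneg hcover fun z _ _ => sq_nonneg _
    _ ≤ (2 * C + 2) ^ N * (L * n 0 + I) := hind N le_rfl
    _ ≤ _ := by gcongr

/-- The inequality at a fixed scale `s`, with constants independent of `s`. -/
theorem exists_sum_sq_sub_le_coneIncrement (d : ℕ) {τ : ℝ} (hτ : 0 < τ) :
    ∃ C M s₁ : ℝ, 0 ≤ C ∧ 1 ≤ M ∧ 1 ≤ s₁ ∧
      ∀ Γ : Configuration d, (∀ x, Real.cos (Γ x).angle ≤ 1 - 4 * τ) →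
      ∀ (f : ZLat d → ℝ) (s : ℝ), s₁ ≤ s → ∀ (x₀ : Euc d) (R : ℝ),
        ∑ x ∈ latticeBall x₀ R, ∑ z ∈ latticeBall x.toEuc s, (f x - f z) ^ 2 ≤
          C * ∑ z ∈ latticeBall x₀ (R + M * s), ∑ w ∈ latticeBall x₀ (R + M * s),
            coneIncrement Γ f (τ / 4 * s) (M * s) z w := by
  obtain ⟨N, hN⟩ := pow_unbounded_of_one_lt (2 / τ)
    (show 1 < 1 + τ ^ 2 / 8 by have := pow_pos hτ 2; linarith)
  set K := (1 + τ ^ 2 / 8) ^ N with hK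
  have hK1 : 1 ≤ K := one_le_pow₀ (by have := pow_pos hτ 2; linarith)
  set C₁ := (3 * K / (τ ^ 2 / 16 / (d + 1))) ^ d with hC₁
  have hC₁0 : 0 ≤ C₁ := by positivity
  refine ⟨(2 * C₁ + 2) ^ N * (1 + 2 ^ d * C₁), 2 * K, 1 + (d + 1) / (τ ^ 2 / 16), by positivity,
    by linarith, by have : 0 ≤ ((d : ℝ) + 1) / (τ ^ 2 / 16) := by positivity
                    linarith, ?_⟩
  intro Γ hΓ f s hs x₀ R
  have hs' : ((d : ℝ) + 1) / (τ ^ 2 / 16) ≤ s := by linarith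
  have hs1 : 1 ≤ s := by
    have : 0 ≤ ((d : ℝ) + 1) / (τ ^ 2 / 16) := by positivity
    linarith
  have hsd : (d : ℝ) + 1 ≤ τ ^ 2 / 16 * s := by
    rw [div_le_iff₀ (by positivity)] at hs'; linarith
  set L := (τ ^ 2 / 16 * s / (d + 1)) ^ d with hL
  have hL0 : 0 < L := by positivity
  have hCL : C₁ * L = (3 * (K * s)) ^ d := by
    rw [hC₁, hL, ← mul_pow]
    congr 1
    field_simp
  set E := coneIncrement Γ f (τ / 4 * s) (2 * K * s) with hE
  have hE0 : ∀ z w, 0 ≤ E z w := coneIncrement_nonneg _ _ _ _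
  set D := latticeBall x₀ (R + 2 * K * s) with hD
  set I := ∑ z ∈ D, ∑ w ∈ D, E z w with hI
  have hI0 : 0 ≤ I := Finset.sum_nonneg fun z _ => Finset.sum_nonneg fun w _ => hE0 z w
  have hpos : 0 < 2 * K * s := by positivity
  have hsub : ∀ x ∈ latticeBall x₀ R, latticeBall x.toEuc (2 * K * s) ⊆ D := by
    intro x hx z hz
    rw [mem_latticeBall] at hx hz
    rw [hD, mem_latticeBall]
    have h2 := norm_add_le (z.toEuc - x.toEuc) (x.toEuc - x₀)
    rw [sub_add_sub_cancel] at h2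
    linarith
  have hRD : latticeBall x₀ R ⊆ D := fun x hx => by
    rw [mem_latticeBall] at hx
    rw [hD, mem_latticeBall]; linarith
  have hfirst : ∑ x ∈ latticeBall x₀ R, ∑ w ∈ latticeBall x.toEuc (2 * K * s), E x w ≤ I :=
    calc _ ≤ ∑ x ∈ latticeBall x₀ R, ∑ w ∈ D, E x w :=
          Finset.sum_le_sum fun x hx => Finset.sum_le_sum_of_subset_of_nonneg
            (hsub x hx) fun w _ _ => hE0 x w
      _ ≤ _ := Finset.sum_le_sum_of_subset_of_nonneg hRD fun z _ _ =>
            Finset.sum_nonneg fun w _ => hE0 z w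
  -- Every pair `(z, w)` is counted by at most as many `x` as there are lattice points near `z`.
  have hsecond : ∑ x ∈ latticeBall x₀ R, ∑ z ∈ latticeBall x.toEuc (2 * K * s),
      ∑ w ∈ latticeBall x.toEuc (2 * K * s), E z w ≤ 2 ^ d * (C₁ * L) * I := by
    calc _ ≤ ∑ x ∈ latticeBall x₀ R, ∑ z ∈ latticeBall x.toEuc (2 * K * s), ∑ w ∈ D, E z w :=
          Finset.sum_le_sum fun x hx => Finset.sum_le_sum fun z _ =>
            Finset.sum_le_sum_of_subset_of_nonneg (hsub x hx) fun w _ _ => hE0 z w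
      _ = ∑ z ∈ D, ∑ x ∈ latticeBall x₀ R with x ∈ latticeBall z.toEuc (2 * K * s),
            ∑ w ∈ D, E z w := by
          refine Finset.sum_comm' fun x z => ?_
          rw [Finset.mem_filter]
          constructor
          · rintro ⟨hx, hz⟩
            refine ⟨⟨hx, ?_⟩, hsub x hx hz⟩
            rw [mem_latticeBall] at hz ⊢
            rwa [norm_sub_rev]
          · rintro ⟨⟨hx, hz⟩, -⟩
            refine ⟨hx, ?_⟩
            rw [mem_latticeBall] at hz ⊢
            rwa [norm_sub_rev]
      _ ≤ ∑ z ∈ D, 2 ^ d * (C₁ * L) * ∑ w ∈ D, E z w := by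
          refine Finset.sum_le_sum fun z _ => ?_
          rw [Finset.sum_const, nsmul_eq_mul]
          refine mul_le_mul_of_nonneg_right ?_ (Finset.sum_nonneg fun w _ => hE0 z w)
          calc _ ≤ ((latticeBall z.toEuc (2 * K * s)).card : ℝ) :=
                Nat.cast_le.2 (Finset.card_le_card fun x hx => (Finset.mem_filter.1 hx).2)
            _ ≤ (3 * (2 * K * s)) ^ d := card_latticeBall_le _ (by nlinarith)
            _ = _ := by rw [hCL, ← mul_pow]; ring
      _ = _ := by rw [← Finset.mul_sum]
  have hsum : L * ∑ x ∈ latticeBall x₀ R, ∑ z ∈ latticeBall x.toEuc s, (f x - f z) ^ 2 ≤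
      (2 * C₁ + 2) ^ N * (L * I + 2 ^ d * (C₁ * L) * I) := by
    rw [Finset.mul_sum]
    calc _ ≤ ∑ x ∈ latticeBall x₀ R, (2 * C₁ + 2) ^ N *
          (L * ∑ w ∈ latticeBall x.toEuc (2 * K * s), E x w +
            ∑ z ∈ latticeBall x.toEuc (2 * K * s),
              ∑ w ∈ latticeBall x.toEuc (2 * K * s), E z w) :=
          Finset.sum_le_sum fun x _ =>
            mul_sum_sq_sub_le_coneIncrement hτ hΓ hK hN.le hs1 hsd hCL.ge f x
      _ ≤ _ := by
          rw [← Finset.mul_sum, Finset.sum_add_distrib, ← Finset.mul_sum]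
          gcongr
  refine le_of_mul_le_mul_left (hsum.trans_eq ?_) hL0
  ring

/-! ### Summation over dyadic scales -/

theorem sum_dyadic_le_two (J : ℕ) {s t : ℝ} (hs : 0 < s) (ht : 0 < t) :
    ∑ j ∈ Finset.range J, (if t ≤ s * 2 ^ j then t / (s * 2 ^ j) else 0) ≤ 2 := by
  induction J generalizing s with
  | zero => simp
  | succ J ih =>
    by_cases h : t ≤ s
    · calc _ ≤ ∑ j ∈ Finset.range (J + 1), (1 / 2 : ℝ) ^ j := by
            refine Finset.sum_le_sum fun j _ => ?_
            split_ifs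
            · rw [div_pow, one_pow, div_le_div_iff₀ (by positivity) (by positivity)]
              have : (0 : ℝ) < 2 ^ j := by positivity
              nlinarith
            · positivity
        _ ≤ 2 := sum_geometric_two_le _
    · rw [Finset.sum_range_succ', pow_zero, mul_one, if_neg h, add_zero]
      refine le_trans (le_of_eq ?_) (ih (s := 2 * s) (by positivity))
      refine Finset.sum_congr rfl fun j _ => ?_
      rw [pow_succ', ← mul_assoc, mul_comm s 2]

theorem sum_dyadic_rpow_le (J : ℕ) {s t β : ℝ} (hs : 0 < s) (ht : 0 < t) (hβ : 1 ≤ β) :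
    ∑ j ∈ Finset.range J, (if t ≤ s * 2 ^ j then (s * 2 ^ j) ^ (-β) else 0) ≤
      2 * t ^ (-β) := by
  have htβ : 0 < t ^ (-β) := Real.rpow_pos_of_pos ht _
  calc _ ≤ ∑ j ∈ Finset.range J,
        t ^ (-β) * (if t ≤ s * 2 ^ j then t / (s * 2 ^ j) else 0) := by
        refine Finset.sum_le_sum fun j _ => ?_
        split_ifs with h
        · have hq : 0 < s * 2 ^ j := by positivity
          have h1 : (s * 2 ^ j) ^ (-β) = t ^ (-β) * (t / (s * 2 ^ j)) ^ β := by
            rw [Real.div_rpow ht.le hq.le, Real.rpow_neg ht.le, Real.rpow_neg hq.le]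
            have := (Real.rpow_pos_of_pos ht β).ne'
            field_simp
          rw [h1]
          gcongr
          exact Real.rpow_le_self_of_le_one (by positivity) ((div_le_one hq).2 h) hβ
        · simp
    _ = t ^ (-β) * ∑ j ∈ Finset.range J, (if t ≤ s * 2 ^ j then t / (s * 2 ^ j) else 0) := by
        rw [Finset.mul_sum]
    _ ≤ t ^ (-β) * 2 := by gcongr; exact sum_dyadic_le_two J hs ht
    _ = _ := mul_comm _ _

/-- If `s ≤ q r`, then `r ^ (-β)` is at most a constant, uniform in `β ≤ n`, times `s ^ (-β)`. -/
theorem rpow_neg_le_pow_mul_rpow_neg {r s q β : ℝ} {n : ℕ} (hs : 0 < s) (hq : 1 ≤ q)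
    (h : s ≤ q * r) (hβ : 0 ≤ β) (hβn : β ≤ n) : r ^ (-β) ≤ q ^ n * s ^ (-β) := by
  have hq0 : 0 < q := by linarith
  calc r ^ (-β) ≤ (s / q) ^ (-β) :=
        Real.rpow_le_rpow_of_nonpos (by positivity) ((div_le_iff₀' hq0).2 h) (by linarith)
    _ = q ^ β * s ^ (-β) := by
        rw [Real.div_rpow hs.le hq0.le, Real.rpow_neg hq0.le]
        field_simp
    _ ≤ q ^ n * s ^ (-β) := by
        gcongr
        rw [← Real.rpow_natCast]
        exact Real.rpow_le_rpow_of_exponent_le hq hβn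

open Classical in
/-- The comparison of the two forms, as finite sums over lattice points. Only the cone at the first
point of each pair is used on the right. -/
theorem exists_sum_sq_sub_mul_rpow_le (d : ℕ) (hd : 1 ≤ d) {τ R₀ : ℝ} (hτ : 0 < τ)
    (hR₀ : 0 < R₀) :
    ∃ κ c : ℝ, 1 ≤ κ ∧ 0 ≤ c ∧ ∀ α : ℝ, 0 < α → α < 2 →
      ∀ Γ : Configuration d, (∀ x, Real.cos (Γ x).angle ≤ 1 - 4 * τ) →
      ∀ R : ℝ, 0 < R → ∀ (x₀ : Euc d) (f : ZLat d → ℝ),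
        ∑ x ∈ latticeBall x₀ R, ∑ z ∈ latticeBall x₀ R,
          (if R₀ < ‖x.toEuc - z.toEuc‖ then (f x - f z) ^ 2 * stableKernel α x z else 0) ≤
        c * ∑ z ∈ latticeBall x₀ (κ * R), ∑ w ∈ latticeBall x₀ (κ * R),
          (if R₀ < ‖z.toEuc - w.toEuc‖ then (f z - f w) ^ 2 *
            (if w.toEuc ∈ Γ.cone z.toEuc then stableKernel α z w else 0) else 0) := by
  obtain ⟨C, M, s₁, hC, hM, hs₁, hmain⟩ := exists_sum_sq_sub_le_coneIncrement d hτ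
  -- From the scale `s₀` on, pairs of length at least `τ / 4 * s` are longer than `R₀`.
  set s₀ := s₁ + 4 * R₀ / τ with hs₀
  have hs₀1 : s₁ ≤ s₀ := le_add_of_nonneg_right (by positivity)
  have hs₀R : R₀ < τ / 4 * s₀ := by
    have : τ / 4 * s₀ = τ / 4 * s₁ + R₀ := by rw [hs₀]; field_simp
    rw [this]
    have : 0 < τ / 4 * s₁ := by positivity
    linarith
  have hs₀0 : 0 < s₀ := by linarith
  set q := 2 + s₀ / R₀ with hq
  have hq2 : 2 ≤ q := le_add_of_nonneg_right (by positivity)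
  have hM0 : 0 ≤ M * (2 * s₀ / R₀ + 4) := by positivity
  refine ⟨1 + M * (2 * s₀ / R₀ + 4), q ^ (d + 2) * C * (2 * M ^ (d + 2)), by linarith,
    by positivity, ?_⟩
  intro α hα0 hα2 Γ hΓ R hR x₀ f
  set κ := 1 + M * (2 * s₀ / R₀ + 4) with hκ
  set β := (d : ℝ) + α with hβ
  have hβ1 : 1 ≤ β := by
    have : (1 : ℝ) ≤ d := by exact_mod_cast hd
    linarith
  have hβd : β ≤ (d + 2 : ℕ) := by push_cast; linarith
  have hker : ∀ x y : ZLat d, stableKernel α x y = ‖x.toEuc - y.toEuc‖ ^ (-β) := by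
    intro x y
    rw [stableKernel, hβ, neg_add']
  have hrhs : ∀ z w : ZLat d, 0 ≤ (if R₀ < ‖z.toEuc - w.toEuc‖ then (f z - f w) ^ 2 *
      (if w.toEuc ∈ Γ.cone z.toEuc then stableKernel α z w else 0) else 0) := by
    intro z w
    have : 0 ≤ stableKernel α z w := by rw [hker]; positivity
    positivity
  have hdist : ∀ x ∈ latticeBall x₀ R, ∀ z ∈ latticeBall x₀ R, ‖x.toEuc - z.toEuc‖ < 2 * R := by
    intro x hx z hz
    rw [mem_latticeBall] at hx hz
    have := norm_sub_le (x.toEuc - x₀) (z.toEuc - x₀)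
    rw [sub_sub_sub_cancel_right] at this
    linarith
  rcases le_or_gt (2 * R) R₀ with hRR | hRR
  · refine le_trans (le_of_eq ?_) (mul_nonneg (by positivity)
      (Finset.sum_nonneg fun z _ => Finset.sum_nonneg fun w _ => hrhs z w))
    refine Finset.sum_eq_zero fun x hx => Finset.sum_eq_zero fun z hz => if_neg ?_
    linarith [hdist x hx z hz]
  -- The largest scale `s₀ * 2 ^ J` needed is comparable to `R`.
  obtain ⟨J, hJ, hJκ⟩ : ∃ J : ℕ, 2 * R < s₀ * 2 ^ J ∧
      s₀ * 2 ^ J ≤ (2 * s₀ / R₀ + 4) * R := by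
    have hex : ∃ J : ℕ, 2 * R < s₀ * 2 ^ J := by
      obtain ⟨J, hJ⟩ := pow_unbounded_of_one_lt (2 * R / s₀) one_lt_two
      exact ⟨J, by rwa [div_lt_iff₀' hs₀0] at hJ⟩
    refine ⟨Nat.find hex, Nat.find_spec hex, ?_⟩
    have h1 : s₀ ≤ 2 * s₀ / R₀ * R := by
      rw [div_mul_eq_mul_div, le_div_iff₀ hR₀]; nlinarith
    rcases Nat.eq_zero_or_pos (Nat.find hex) with h0 | h0
    · rw [h0, pow_zero, mul_one]; linarith
    · have h2 := Nat.find_min hex (Nat.sub_lt h0 one_pos)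
      have h3 : (2 : ℝ) ^ Nat.find hex = 2 * 2 ^ (Nat.find hex - 1) := by
        rw [← pow_succ']; congr 1; omega
      rw [not_lt] at h2
      rw [h3]; linarith
  have hsj : ∀ j, s₀ ≤ s₀ * 2 ^ j := fun j =>
    le_mul_of_one_le_right hs₀0.le (one_le_pow₀ one_le_two)
  have hsj0 : ∀ j, 0 < s₀ * 2 ^ j := fun j => by positivity
  have hW0 : ∀ j, 0 ≤ (s₀ * 2 ^ j) ^ (-β) := fun j => Real.rpow_nonneg (hsj0 j).le _
  -- Each far pair is seen at the first scale exceeding its length.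
  have hpair : ∀ x ∈ latticeBall x₀ R, ∀ z ∈ latticeBall x₀ R,
      (if R₀ < ‖x.toEuc - z.toEuc‖ then (f x - f z) ^ 2 * stableKernel α x z else 0) ≤
      ∑ j ∈ Finset.range (J + 1), (if ‖z.toEuc - x.toEuc‖ < s₀ * 2 ^ j then
        q ^ (d + 2) * (s₀ * 2 ^ j) ^ (-β) * (f x - f z) ^ 2 else 0) := by
    intro x hx z hz
    have hterm : ∀ j ∈ Finset.range (J + 1), 0 ≤ (if ‖z.toEuc - x.toEuc‖ < s₀ * 2 ^ j then
        q ^ (d + 2) * (s₀ * 2 ^ j) ^ (-β) * (f x - f z) ^ 2 else 0) := fun j _ => by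
      have := hW0 j
      positivity
    split_ifs with hfar
    swap
    · exact Finset.sum_nonneg hterm
    have hr0 : 0 < ‖x.toEuc - z.toEuc‖ := hR₀.trans hfar
    obtain ⟨j, hjJ, hj, hjq⟩ : ∃ j ≤ J, ‖x.toEuc - z.toEuc‖ < s₀ * 2 ^ j ∧
        s₀ * 2 ^ j ≤ q * ‖x.toEuc - z.toEuc‖ := by
      have hex : ∃ j : ℕ, ‖x.toEuc - z.toEuc‖ < s₀ * 2 ^ j := ⟨J, (hdist x hx z hz).trans hJ⟩
      refine ⟨Nat.find hex, Nat.find_min' hex ((hdist x hx z hz).trans hJ), Nat.find_spec hex, ?_⟩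
      rcases Nat.eq_zero_or_pos (Nat.find hex) with h0 | h0
      · rw [h0, pow_zero, mul_one]
        calc s₀ = s₀ / R₀ * R₀ := by field_simp
          _ ≤ q * ‖x.toEuc - z.toEuc‖ := by
              gcongr
              rw [hq]; linarith
      · have h2 := Nat.find_min hex (Nat.sub_lt h0 one_pos)
        have h3 : (2 : ℝ) ^ Nat.find hex = 2 * 2 ^ (Nat.find hex - 1) := by
          rw [← pow_succ']; congr 1; omega
        rw [not_lt] at h2
        rw [h3]
        calc s₀ * (2 * 2 ^ (Nat.find hex - 1)) = 2 * (s₀ * 2 ^ (Nat.find hex - 1)) := by ring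
          _ ≤ q * ‖x.toEuc - z.toEuc‖ := by gcongr
    refine le_trans ?_ (Finset.single_le_sum hterm (Finset.mem_range.2 (Nat.lt_succ_of_le hjJ)))
    rw [if_pos (by rwa [norm_sub_rev]), hker, mul_comm]
    gcongr
    exact rpow_neg_le_pow_mul_rpow_neg (hsj0 j) (by linarith) hjq (by linarith) hβd
  have hscale : ∀ j ∈ Finset.range (J + 1),
      ∑ x ∈ latticeBall x₀ R, ∑ z ∈ latticeBall x₀ R, (if ‖z.toEuc - x.toEuc‖ < s₀ * 2 ^ j then
        q ^ (d + 2) * (s₀ * 2 ^ j) ^ (-β) * (f x - f z) ^ 2 else 0) ≤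
      q ^ (d + 2) * C * ∑ z ∈ latticeBall x₀ (κ * R), ∑ w ∈ latticeBall x₀ (κ * R),
        (s₀ * 2 ^ j) ^ (-β) *
          coneIncrement Γ f (τ / 4 * (s₀ * 2 ^ j)) (M * (s₀ * 2 ^ j)) z w := by
    intro j hj
    have hjJ : j ≤ J := Nat.lt_succ_iff.1 (Finset.mem_range.1 hj)
    have hW := hW0 j
    have hRκ : R + M * (s₀ * 2 ^ j) ≤ κ * R := by
      have h1 : s₀ * 2 ^ j ≤ s₀ * 2 ^ J := by gcongr; exact one_le_two
      have h2 : M * (s₀ * 2 ^ j) ≤ M * ((2 * s₀ / R₀ + 4) * R) :=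
        mul_le_mul_of_nonneg_left (h1.trans hJκ) (by linarith)
      rw [hκ]; linarith
    have hsub : latticeBall x₀ (R + M * (s₀ * 2 ^ j)) ⊆ latticeBall x₀ (κ * R) := fun z hz => by
      rw [mem_latticeBall] at hz ⊢; linarith
    set W := (s₀ * 2 ^ j) ^ (-β) with hWdef
    calc _ ≤ ∑ x ∈ latticeBall x₀ R, ∑ z ∈ latticeBall x.toEuc (s₀ * 2 ^ j),
            q ^ (d + 2) * W * (f x - f z) ^ 2 := by
          refine Finset.sum_le_sum fun x _ => ?_
          rw [← Finset.sum_filter]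
          refine Finset.sum_le_sum_of_subset_of_nonneg (fun z hz => ?_) fun z _ _ => by positivity
          exact mem_latticeBall.2 (Finset.mem_filter.1 hz).2
      _ = q ^ (d + 2) * W * ∑ x ∈ latticeBall x₀ R, ∑ z ∈ latticeBall x.toEuc (s₀ * 2 ^ j),
            (f x - f z) ^ 2 := by
          simp only [Finset.mul_sum]
      _ ≤ q ^ (d + 2) * W * (C * ∑ z ∈ latticeBall x₀ (R + M * (s₀ * 2 ^ j)),
            ∑ w ∈ latticeBall x₀ (R + M * (s₀ * 2 ^ j)),
              coneIncrement Γ f (τ / 4 * (s₀ * 2 ^ j)) (M * (s₀ * 2 ^ j)) z w) := by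
          gcongr
          exact hmain Γ hΓ f _ (hs₀1.trans (hsj j)) x₀ R
      _ ≤ q ^ (d + 2) * W * (C * ∑ z ∈ latticeBall x₀ (κ * R), ∑ w ∈ latticeBall x₀ (κ * R),
              coneIncrement Γ f (τ / 4 * (s₀ * 2 ^ j)) (M * (s₀ * 2 ^ j)) z w) := by
          gcongr
          refine (Finset.sum_le_sum fun z _ => Finset.sum_le_sum_of_subset_of_nonneg hsub
            fun w _ _ => coneIncrement_nonneg _ _ _ _ z w).trans ?_
          exact Finset.sum_le_sum_of_subset_of_nonneg hsub fun z _ _ =>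
            Finset.sum_nonneg fun w _ => coneIncrement_nonneg _ _ _ _ z w
      _ = _ := by
          simp only [← Finset.mul_sum]
          ring
  have hedge : ∀ z w : ZLat d, ∑ j ∈ Finset.range (J + 1), (s₀ * 2 ^ j) ^ (-β) *
      coneIncrement Γ f (τ / 4 * (s₀ * 2 ^ j)) (M * (s₀ * 2 ^ j)) z w ≤
      2 * M ^ (d + 2) * (if R₀ < ‖z.toEuc - w.toEuc‖ then (f z - f w) ^ 2 *
        (if w.toEuc ∈ Γ.cone z.toEuc then stableKernel α z w else 0) else 0) := by
    intro z w
    by_cases h : R₀ < ‖z.toEuc - w.toEuc‖ ∧ w.toEuc ∈ Γ.cone z.toEuc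
    · obtain ⟨hfar, hcone⟩ := h
      rw [if_pos hfar, if_pos hcone, hker]
      set r := ‖z.toEuc - w.toEuc‖ with hr
      have hr0 : 0 < r := hR₀.trans hfar
      have hM0 : 0 < M := by linarith
      calc _ ≤ ∑ j ∈ Finset.range (J + 1),
            (if r / M ≤ s₀ * 2 ^ j then (s₀ * 2 ^ j) ^ (-β) else 0) * (f z - f w) ^ 2 := by
            refine Finset.sum_le_sum fun j _ => ?_
            unfold coneIncrement
            have := hW0 j
            split_ifs with h1 h2 h2
            · exact le_rfl
            · exact absurd ((div_le_iff₀' hM0).2 h1.2.2) h2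
            · rw [mul_zero]; positivity
            · simp
        _ ≤ 2 * (r / M) ^ (-β) * (f z - f w) ^ 2 := by
            rw [← Finset.sum_mul]
            gcongr
            exact sum_dyadic_rpow_le _ hs₀0 (by positivity) hβ1
        _ ≤ 2 * (M ^ (d + 2) * r ^ (-β)) * (f z - f w) ^ 2 := by
            gcongr
            refine rpow_neg_le_pow_mul_rpow_neg hr0 hM ?_ (by linarith) hβd
            rw [mul_div_cancel₀ _ hM0.ne']
        _ = _ := by ring
    · refine le_trans (le_of_eq ?_) (mul_nonneg (by positivity) (hrhs z w))
      refine Finset.sum_eq_zero fun j _ => ?_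
      rw [coneIncrement, if_neg, mul_zero]
      rintro ⟨h1, h2, -⟩
      refine h ⟨?_, h1⟩
      have : τ / 4 * s₀ ≤ τ / 4 * (s₀ * 2 ^ j) := by gcongr; exact hsj j
      linarith
  calc _ ≤ ∑ x ∈ latticeBall x₀ R, ∑ z ∈ latticeBall x₀ R, ∑ j ∈ Finset.range (J + 1),
        (if ‖z.toEuc - x.toEuc‖ < s₀ * 2 ^ j then
          q ^ (d + 2) * (s₀ * 2 ^ j) ^ (-β) * (f x - f z) ^ 2 else 0) :=
        Finset.sum_le_sum fun x hx => Finset.sum_le_sum fun z hz => hpair x hx z hz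
    _ = ∑ j ∈ Finset.range (J + 1), ∑ x ∈ latticeBall x₀ R, ∑ z ∈ latticeBall x₀ R,
        (if ‖z.toEuc - x.toEuc‖ < s₀ * 2 ^ j then
          q ^ (d + 2) * (s₀ * 2 ^ j) ^ (-β) * (f x - f z) ^ 2 else 0) := by
        simp_rw [Finset.sum_comm (s := latticeBall x₀ R) (t := Finset.range (J + 1))]
    _ ≤ ∑ j ∈ Finset.range (J + 1), q ^ (d + 2) * C *
        ∑ z ∈ latticeBall x₀ (κ * R), ∑ w ∈ latticeBall x₀ (κ * R), (s₀ * 2 ^ j) ^ (-β) *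
          coneIncrement Γ f (τ / 4 * (s₀ * 2 ^ j)) (M * (s₀ * 2 ^ j)) z w :=
        Finset.sum_le_sum hscale
    _ = q ^ (d + 2) * C * ∑ z ∈ latticeBall x₀ (κ * R), ∑ w ∈ latticeBall x₀ (κ * R),
        ∑ j ∈ Finset.range (J + 1), (s₀ * 2 ^ j) ^ (-β) *
          coneIncrement Γ f (τ / 4 * (s₀ * 2 ^ j)) (M * (s₀ * 2 ^ j)) z w := by
        rw [← Finset.mul_sum, Finset.sum_comm]
        simp_rw [Finset.sum_comm (s := Finset.range (J + 1))]
    _ ≤ q ^ (d + 2) * C * ∑ z ∈ latticeBall x₀ (κ * R), ∑ w ∈ latticeBall x₀ (κ * R),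
        2 * M ^ (d + 2) * (if R₀ < ‖z.toEuc - w.toEuc‖ then (f z - f w) ^ 2 *
          (if w.toEuc ∈ Γ.cone z.toEuc then stableKernel α z w else 0) else 0) := by
        gcongr with z _ w _
        exact hedge z w
    _ = _ := by
        simp only [← Finset.mul_sum]
        ring

/-! ### The quadratic form as a finite sum -/

open Classical in
theorem discreteForm_ofReal {d : ℕ} (R₀ : ℝ) {g : ZLat d → ZLat d → ℝ} (hg : ∀ x y, 0 ≤ g x y)
    (f : ZLat d → ℝ) (x₀ : Euc d) (R : ℝ) :
    discreteForm R₀ (fun x y => ENNReal.ofReal (g x y)) f x₀ R =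
      ENNReal.ofReal (∑ x ∈ latticeBall x₀ R, ∑ y ∈ latticeBall x₀ R,
        (if R₀ < ‖x.toEuc - y.toEuc‖ then (f x - f y) ^ 2 * g x y else 0)) := by
  rw [← Finset.sum_product', ENNReal.ofReal_sum_of_nonneg fun p _ => by
    have := hg p.1 p.2
    positivity]
  rw [discreteForm, tsum_subtype (farPairs R₀ x₀ R)
    (fun p => ENNReal.ofReal ((f p.1 - f p.2) ^ 2) * ENNReal.ofReal (g p.1 p.2)),
    tsum_eq_sum (s := latticeBall x₀ R ×ˢ latticeBall x₀ R)]
  · refine Finset.sum_congr rfl fun p hp => ?_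
    rw [Finset.mem_product, mem_latticeBall, mem_latticeBall] at hp
    rw [Set.indicator_apply]
    by_cases h : R₀ < ‖p.1.toEuc - p.2.toEuc‖
    · rw [if_pos h, if_pos ⟨mem_ball_iff_norm.2 hp.1, mem_ball_iff_norm.2 hp.2, h⟩,
        ENNReal.ofReal_mul (sq_nonneg _)]
    · rw [if_neg h, if_neg fun hh => h hh.2.2, ENNReal.ofReal_zero]
  · intro p hp
    refine Set.indicator_of_notMem (fun h => hp ?_) _
    rw [Finset.mem_product, mem_latticeBall, mem_latticeBall]
    exact ⟨mem_ball_iff_norm.1 h.1, mem_ball_iff_norm.1 h.2.1⟩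

theorem discreteForm_mono {d : ℕ} {R₀ : ℝ} {w w' : ZLat d → ZLat d → ℝ≥0∞}
    (h : ∀ x y : ZLat d, R₀ < ‖x.toEuc - y.toEuc‖ → w x y ≤ w' x y)
    (f : ZLat d → ℝ) (x₀ : Euc d) (R : ℝ) :
    discreteForm R₀ w f x₀ R ≤ discreteForm R₀ w' f x₀ R :=
  ENNReal.tsum_le_tsum fun p => mul_le_mul_right (h _ _ p.2.2.2) _

theorem theorem1p2 (d : ℕ) (Λ ϑ R₀ : ℝ) (hΛ : 1 ≤ Λ) (hR₀ : 0 < R₀) :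
    ∃ κ c : ℝ, 1 ≤ κ ∧ 1 ≤ c ∧
      ∀ (α : ℝ), 0 < α → α < 2 →
      ∀ (Γ : Configuration d), Γ.IsBounded ϑ →
      ∀ (ω : ZLat d → ZLat d → ℝ≥0∞),
        (∀ x y, ω x y = ω y x) →
        (∀ x y : ZLat d, R₀ < ‖x.toEuc - y.toEuc‖ →
          ENNReal.ofReal (Λ⁻¹ * coneCount Γ x y * stableKernel α x y) ≤ ω x y ∧
          ω x y ≤ ENNReal.ofReal (Λ * stableKernel α x y)) →
      ∀ (R : ℝ), 0 < R → ∀ (x₀ : Euc d) (f : ZLat d → ℝ),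
        discreteForm R₀ (fun x y => ENNReal.ofReal (stableKernel α x y)) f x₀ R ≤
          ENNReal.ofReal c * discreteForm R₀ ω f x₀ (κ * R) := by
  classical
  -- Bounded configurations exist only if `d ≥ 1` and `0 < ϑ ≤ π / 2`.
  have hbdd : ∀ Γ : Configuration d, Γ.IsBounded ϑ → 1 ≤ d ∧ 0 < ϑ ∧ ϑ ≤ Real.pi / 2 := by
    intro Γ hΓ
    refine ⟨Nat.one_le_iff_ne_zero.2 ?_, hΓ.1, (hΓ.2.1 ⟨0, rfl⟩).trans (Γ 0).angle_le⟩
    rintro rfl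
    have := (Γ 0).norm_axis
    rw [Subsingleton.elim (Γ 0).axis 0, norm_zero] at this
    exact zero_ne_one this
  by_cases hpar : 1 ≤ d ∧ 0 < ϑ ∧ ϑ ≤ Real.pi / 2
  swap
  · exact ⟨1, 1, le_rfl, le_rfl, fun α _ _ Γ hΓ => absurd (hbdd Γ hΓ) hpar⟩
  obtain ⟨hd, hϑ0, hϑ⟩ := hpar
  have hcos : Real.cos ϑ < 1 := by
    rw [← Real.cos_zero]
    exact Real.cos_lt_cos_of_nonneg_of_le_pi_div_two le_rfl hϑ hϑ0
  obtain ⟨κ, c, hκ, hc, hmain⟩ := exists_sum_sq_sub_mul_rpow_le d hd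
    (show 0 < (1 - Real.cos ϑ) / 4 by linarith) hR₀
  refine ⟨κ, 1 + c * Λ, hκ, le_add_of_nonneg_right (by positivity), ?_⟩
  intro α hα0 hα2 Γ hΓ ω _ hω R hR x₀ f
  have hangle : ∀ x, Real.cos (Γ x).angle ≤ 1 - 4 * ((1 - Real.cos ϑ) / 4) := by
    intro x
    have := Real.cos_le_cos_of_nonneg_of_le_pi hϑ0.le
      ((Γ x).angle_le.trans (by linarith [Real.pi_pos])) (hΓ.2.1 ⟨x, rfl⟩)
    linarith
  have hk : ∀ x y : ZLat d, 0 ≤ stableKernel α x y := fun x y => Real.rpow_nonneg (norm_nonneg _) _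
  set g : ZLat d → ZLat d → ℝ := fun x y =>
    if y.toEuc ∈ Γ.cone x.toEuc then stableKernel α x y else 0 with hg
  have hg0 : ∀ x y, 0 ≤ g x y := fun x y => by
    have := hk x y
    positivity
  have hgω : discreteForm R₀ (fun x y => ENNReal.ofReal (Λ⁻¹ * g x y)) f x₀ (κ * R) ≤
      discreteForm R₀ ω f x₀ (κ * R) := by
    refine discreteForm_mono (fun x y hxy => le_trans (ENNReal.ofReal_le_ofReal ?_)
      (hω x y hxy).1) f x₀ _
    rw [mul_assoc]
    gcongr
    have := hk x y
    simp only [hg, coneCount]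
    split_ifs <;> linarith
  have hΛ0 : 0 < Λ := by linarith
  refine le_trans ?_ (mul_le_mul_right hgω _)
  rw [discreteForm_ofReal R₀ hk, discreteForm_ofReal R₀ fun x y => by
    have := hg0 x y
    positivity]
  rw [← ENNReal.ofReal_mul (by positivity)]
  refine ENNReal.ofReal_le_ofReal ?_
  set S := ∑ z ∈ latticeBall x₀ (κ * R), ∑ w ∈ latticeBall x₀ (κ * R),
    (if R₀ < ‖z.toEuc - w.toEuc‖ then (f z - f w) ^ 2 * g z w else 0) with hS
  have hS0 : 0 ≤ S := Finset.sum_nonneg fun z _ => Finset.sum_nonneg fun w _ => by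
    have := hg0 z w
    positivity
  have hscale : ∑ z ∈ latticeBall x₀ (κ * R), ∑ w ∈ latticeBall x₀ (κ * R),
      (if R₀ < ‖z.toEuc - w.toEuc‖ then (f z - f w) ^ 2 * (Λ⁻¹ * g z w) else 0) = Λ⁻¹ * S := by
    simp only [hS, Finset.mul_sum, mul_ite, mul_zero]
    refine Finset.sum_congr rfl fun z _ => Finset.sum_congr rfl fun w _ => ?_
    split_ifs
    · ring
    · rfl
  rw [hscale]
  calc _ ≤ c * S := hmain α hα0 hα2 Γ hangle R hR x₀ f
    _ = c * Λ * (Λ⁻¹ * S) := by field_simp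
    _ ≤ _ := by
        have : 0 ≤ Λ⁻¹ * S := by positivity
        gcongr
        linarith
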